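/- Setting. A correlation is a joint probability distribution $P=[P(x,y)]$, viewed as a nonnegative matrix with entries summing to $1$. A density operator $\rho$ on $\mathbb{C}^a\otimes\mathbb{C}^b$ *generates* an $n\times n$ correlation $P$ without noise, written $\rho\xrightarrow{0}P$, if there are POVMs $\{E_x\}_{x=1}^n$ on $\mathbb{C}^a$ and $\{F_y\}_{y=1}^n$ on $\mathbb{C}^b$ with $P(x,y)=\operatorname{tr}((E_x\otimes F_y)\rho)$ for all $x,y$; its size is half the total number of qubits, $\operatorname{size}(\rho)=\frac12(\lceil\log_2 a\rceil+\lceil\log_2 b\rceil)$. A correlation $P'$ on $[k]\times[l]$, of size $\frac12(\lceil\log_2 k\rceil+\lceil\log_2 l\rceil)$, generates $P$ classically if $P$ arises from $P'$ by local stochastic maps on the two sides; $\mathrm{R}(P)$ is the least size of a correlation that generates $P$ classically. The noiseless quantum advantage is $\mathcal{S}_0(P)=\mathrm{R}(P)/\inf\{\operatorname{size}(\rho):\rho\xrightarrow{0}P\}$ (with $0/0=0$ for product distributions). For a nonnegative matrix $M$, $\operatorname{rank}_+(M)$ is the least $r$ such that $M$ is a sum of $r$ nonnegative rank-one matrices,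 and $\operatorname{rank}_{\mathrm{psd}}(M)$ is the least $r$ such that $M(x,y)=\operatorname{tr}(C_xD_y)$ for some positive semidefinite $C_x,D_y\in\mathbb{C}^{r\times r}$. For $m\ge 2$ distinct reals $\alpha_1,\dots,\alpha_m$ let $\mathrm{EDM}_\alpha(x,y)=(\alpha_x-\alpha_y)^2/\sum_{i,j}(\alpha_i-\alpha_j)^2$. Theorem. Let $|\psi\rangle\in\mathbb{C}^a\otimes\mathbb{C}^b$ be an entangled (i.e. non-product) unit vector. Then there is a family of correlations $\{P_m\}_{m\ge 1}$, $P_m$ of size $(m+1)\times(m+1)$, such that $|\psi\rangle\langle\psi|\xrightarrow{0}P_m$ for all $m\ge 1$ and $\lim_{m\to\infty}\mathcal{S}_0(P_m)=\infty$. Moreover, the family can be chosen so that for some $p\in(0,1]$ independent of $m$ and every $m\ge 2$, $$P_m=\begin{pmatrix} p\,\mathrm{EDM}'_m & 0\\ 0 & 1-p\end{pmatrix},\qquad \mathrm{EDM}'_m=L_m\,\mathrm{EDM}_{\alpha^{(m)}}\,R_m,$$ where $\alpha^{(m)}$ consists of $m$ distinct reals, $L_m,R_m$ are diagonal matrices with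 positive diagonal entries, and both $M=\mathrm{EDM}_{\alpha^{(m)}}$ and $M=\mathrm{EDM}'_m$ satisfy $\operatorname{rank}_{\mathrm{psd}}(M)=2$ and $\operatorname{rank}_+(M)\ge 2\sqrt m-2$. -/

import Mathlib

open Filter Topology
open scoped Matrix Kronecker ENNReal ComplexOrder

namespace CorrGen

noncomputable section

/-- A classical correlation: a joint probability distribution written as a matrix. -/
structure IsCorrelation {m n : ℕ} (P : Matrix (Fin m) (Fin n) ℝ) : Prop where
  nonneg : ∀ x y, 0 ≤ P x y
  sum_eq_one : ∑ x, ∑ y, P x y = 1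

/-- The size of a shared resource whose two parts take `k` and `l` values (respectively, have
dimensions `k` and `l`): half of the total number `⌈log₂ k⌉ + ⌈log₂ l⌉` of bits (qubits). -/
def size (k l : ℕ) : ℝ≥0∞ := ((Nat.clog 2 k + Nat.clog 2 l : ℕ) : ℝ≥0∞) / 2

/-! ### Classical protocols -/

/-- A classical channel: `A x i` is the probability of the output `x` on the input `i`. -/
structure IsChannel {n k : ℕ} (A : Matrix (Fin n) (Fin k) ℝ) : Prop where
  nonneg : ∀ x i, 0 ≤ A x i
  sum_eq_one : ∀ i, ∑ x, A x i = 1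

/-- The seed correlation `Q` yields `P` by local classical operations, without communication. -/
def ClassicallyGenerates {k l n : ℕ} (Q : Matrix (Fin k) (Fin l) ℝ)
    (P : Matrix (Fin n) (Fin n) ℝ) : Prop :=
  ∃ (A : Matrix (Fin n) (Fin k) ℝ) (B : Matrix (Fin n) (Fin l) ℝ),
    IsChannel A ∧ IsChannel B ∧ ∀ x y, P x y = ∑ i, ∑ j, A x i * B y j * Q i j

/-- The classical correlation complexity `R(P)`: the least size of a seed correlation that
generates `P`. -/
def classicalCost {n : ℕ} (P : Matrix (Fin n) (Fin n) ℝ) : ℝ≥0∞ :=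
  ⨅ (k : ℕ) (l : ℕ) (Q : Matrix (Fin k) (Fin l) ℝ)
    (_ : IsCorrelation Q ∧ ClassicallyGenerates Q P), size k l

/-! ### Quantum protocols -/

/-- Operators on `ℂ^a ⊗ ℂ^b`. -/
abbrev BiMatrix (a b : ℕ) : Type := Matrix (Fin a × Fin b) (Fin a × Fin b) ℂ

/-- Density operators. -/
structure IsState {a b : ℕ} (ρ : BiMatrix a b) : Prop where
  posSemidef : ρ.PosSemidef
  trace_eq_one : ρ.trace = 1

/-- The partial trace over the first factor. -/
def traceLeft {a b : ℕ} (ρ : BiMatrix a b) : Matrix (Fin b) (Fin b) ℂ :=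
  Matrix.of fun j j' => ∑ i, ρ (i, j) (i, j')

/-- The partial trace over the second factor. -/
def traceRight {a b : ℕ} (ρ : BiMatrix a b) : Matrix (Fin a) (Fin a) ℂ :=
  Matrix.of fun i i' => ∑ j, ρ (i, j) (i', j)

/-- `𝓔_lam ⊗ id`, where `𝓔_lam(σ) = (1 - lam) σ + lam tr(σ) I / d` is the depolarizing channel. -/
def noiseLeft {a b : ℕ} (lam : ℝ) (ρ : BiMatrix a b) : BiMatrix a b :=
  ((1 - lam : ℝ) : ℂ) • ρ
    + ((lam / a : ℝ) : ℂ) • ((1 : Matrix (Fin a) (Fin a) ℂ) ⊗ₖ traceLeft ρ)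

/-- `id ⊗ 𝓔_lam`. -/
def noiseRight {a b : ℕ} (lam : ℝ) (ρ : BiMatrix a b) : BiMatrix a b :=
  ((1 - lam : ℝ) : ℂ) • ρ
    + ((lam / b : ℝ) : ℂ) • (traceRight ρ ⊗ₖ (1 : Matrix (Fin b) (Fin b) ℂ))

/-- The noise `𝓔_lam ⊗ 𝓔_lam`. -/
def noise {a b : ℕ} (lam : ℝ) (ρ : BiMatrix a b) : BiMatrix a b :=
  noiseLeft lam (noiseRight lam ρ)

/-- A positive operator-valued measurement with `n` outcomes on `ℂ^d`. -/
structure IsPOVM {n d : ℕ} (E : Fin n → Matrix (Fin d) (Fin d) ℂ) : Prop where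
  posSemidef : ∀ x, (E x).PosSemidef
  sum_eq_one : ∑ x, E x = 1

/-- `ρ` generates `P` under noise of strength `lam`: local measurements of
`(𝓔_lam ⊗ 𝓔_lam)(ρ)` have the joint outcome distribution `P`. -/
def Generates {a b n : ℕ} (lam : ℝ) (ρ : BiMatrix a b) (P : Matrix (Fin n) (Fin n) ℝ) : Prop :=
  ∃ (E : Fin n → Matrix (Fin a) (Fin a) ℂ) (F : Fin n → Matrix (Fin b) (Fin b) ℂ),
    IsPOVM E ∧ IsPOVM F ∧ ∀ x y, (P x y : ℂ) = ((E x ⊗ₖ F y) * noise lam ρ).trace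

/-- The least size of a seed state that generates `P` under noise of strength `lam`
(`∞` if there is none). -/
def quantumCost {n : ℕ} (lam : ℝ) (P : Matrix (Fin n) (Fin n) ℝ) : ℝ≥0∞ :=
  ⨅ (a : ℕ) (b : ℕ) (ρ : BiMatrix a b) (_ : IsState ρ ∧ Generates lam ρ P), size a b

/-- The quantum advantage `𝓢_lam(P)`. The convention `x / ∞ = 0` applies to unreachable `P`. -/
def quantumAdvantage {n : ℕ} (lam : ℝ) (P : Matrix (Fin n) (Fin n) ℝ) : ℝ≥0∞ :=
  classicalCost P / quantumCost lam P

/-- The operator `|ψ⟩⟨ψ|`. -/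
def pureState {a b : ℕ} (ψ : EuclideanSpace ℂ (Fin a × Fin b)) : BiMatrix a b :=
  Matrix.of fun s t => ψ s * star (ψ t)

/-- A bipartite vector is entangled if it is not a product vector. -/
def IsEntangled {a b : ℕ} (ψ : EuclideanSpace ℂ (Fin a × Fin b)) : Prop :=
  ¬ ∃ (u : Fin a → ℂ) (v : Fin b → ℂ), ∀ i j, ψ (i, j) = u i * v j

/-! ### Ranks and Euclidean distance matrices -/

/-- The nonnegative rank of a nonnegative matrix: the least number of nonnegative rank-one
matrices `u vᵀ` that sum to it. -/
def nonnegRank {n : ℕ} (M : Matrix (Fin n) (Fin n) ℝ) : ℕ :=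
  sInf {r : ℕ | ∃ u v : Fin r → Fin n → ℝ,
    (∀ k x, 0 ≤ u k x) ∧ (∀ k y, 0 ≤ v k y) ∧ ∀ x y, M x y = ∑ k, u k x * v k y}

/-- The positive semidefinite rank of a nonnegative matrix. -/
def psdRank {n : ℕ} (M : Matrix (Fin n) (Fin n) ℝ) : ℕ :=
  sInf {r : ℕ | ∃ C D : Fin n → Matrix (Fin r) (Fin r) ℂ,
    (∀ x, (C x).PosSemidef) ∧ (∀ y, (D y).PosSemidef) ∧
      ∀ x y, (M x y : ℂ) = (C x * D y).trace}

/-- The normalized Euclidean distance matrix of the points `α 0, …, α (m - 1)` of the line. -/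
def edm {m : ℕ} (α : Fin m → ℝ) : Matrix (Fin m) (Fin m) ℝ :=
  Matrix.of fun x y => (α x - α y) ^ 2 / ∑ i, ∑ j, (α i - α j) ^ 2

/-- The rescaled matrix `diag(l) · EDM · diag(r)`. -/
def rescaledEdm {m : ℕ} (α l r : Fin m → ℝ) : Matrix (Fin m) (Fin m) ℝ :=
  Matrix.diagonal l * edm α * Matrix.diagonal r

/-- The block-diagonal matrix with blocks `M` and the `1 × 1` matrix `c`. -/
def addCorner {m : ℕ} (M : Matrix (Fin m) (Fin m) ℝ) (c : ℝ) :
    Matrix (Fin (m + 1)) (Fin (m + 1)) ℝ :=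
  Matrix.reindex finSumFinEquiv finSumFinEquiv
    (Matrix.fromBlocks M 0 0 (Matrix.of fun _ _ : Fin 1 => c))

end

end CorrGen

open CorrGen

/-! One fixed state generates every `P m`, so the quantum cost stays at most `size a b`, while the
classical cost is at least about the logarithm of the nonnegative rank of the distance-matrix block,
which is unbounded.

Quantum side. An entangled vector has two positive Schmidt coefficients `s 0`, `s 1`
(`exists_isSchmidtPair`). Both parties project onto the corresponding two Schmidt vectors. They
succeed together, with probability `p = s 0 ^ 2 + s 1 ^ 2`, or fail together, which gives the corner
`1 - p` (`generates_addCorner`). After success, rank-one effects along `(1, α x)` and `(s 1 / s 0 *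
α y, -1)` have amplitude proportional to `α x - α y`, hence probability proportional to the squared
distance. Such effects sum to the identity exactly when their weights have total mass 1, mean 0 and
a prescribed second moment; suitable positive weights exist for an open set of `α`
(`exists_pos_weights`), so `α` may be taken algebraically independent over `ℚ`.

Classical side. A seed with `k × l` values yields nonnegative factorizations with `k` and with `l`
terms. The rank bound `four_mul_le_sq_of_sq_dist_factorization` is a parameter count. The zero
diagonal forces the two factors to have disjoint supports at each diagonal entry. The row space of
the left factor, of dimension `d` in `ℝ^r`, together with the quadratic polynomials it induces, is
described by `d * (r - d + 2)` numbers, and every `α x` is a root of a nonzero quadratic over the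
field they generate. Comparing transcendence degrees, `m ≤ d * (r - d + 2) ≤ (r + 2) ^ 2 / 4`. -/

/-! ### Algebraically independent real numbers -/

-- This makes parameter counting rigorous: rank in the algebraic independence matroid is at most the
-- number of generators.
open scoped IntermediateField.algebraAdjoinAdjoin in
theorem card_le_of_isAlgebraic_adjoin {ι κ F E : Type*} [Fintype ι] [Fintype κ] [Field F] [Field E]
    [Algebra F E] {α : ι → E} (hα : AlgebraicIndependent F α) (g : κ → E)
    (h : ∀ x, IsAlgebraic (IntermediateField.adjoin F (Set.range g)) (α x)) :
    Fintype.card ι ≤ Fintype.card κ := by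
  have hind : (AlgebraicIndependent.matroid F E).Indep (Set.range α) := hα.to_subtype_range
  have hsub : Set.range α ⊆ (AlgebraicIndependent.matroid F E).closure (Set.range g) := by
    rw [AlgebraicIndependent.matroid_closure_eq]
    rintro _ ⟨x, rfl⟩
    exact (IsFractionRing.isAlgebraic_iff (Algebra.adjoin F (Set.range g))
      (IntermediateField.adjoin F (Set.range g)) E).2 (h x)
  have h1 : (Set.range α).encard ≤ (Set.range g).encard :=
    (hind.encard_le_eRk_of_subset hsub).trans
      ((Matroid.eRk_closure_eq _ _).trans_le (Matroid.eRk_le_encard _ _))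
  have h2 : (Set.range α).encard = Fintype.card ι := by
    rw [← Set.image_univ, hα.injective.encard_image]; simp
  have h3 : (Set.range g).encard ≤ Fintype.card κ := by
    rw [← Set.image_univ]
    exact (Set.encard_image_le _ _).trans (by simp)
  rw [h2] at h1
  exact_mod_cast h1.trans h3

theorem exists_algebraicIndependent_real (m : ℕ) :
    ∃ α : Fin m → ℝ, AlgebraicIndependent ℚ α := by
  obtain ⟨ι, x, hx⟩ := exists_isTranscendenceBasis' ℚ ℝ
  have hinf : Infinite ι := by
    by_contra hfin
    rw [not_infinite_iff_finite] at hfin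
    -- A finite basis would make `ℝ` algebraic over a countable ring, hence countable.
    have : Countable (Algebra.adjoin ℚ (Set.range x)) := by
      rw [← Cardinal.mk_le_aleph0_iff, ← hx.1.aevalEquiv.toEquiv.cardinal_eq]
      refine MvPolynomial.cardinalMk_le_max.trans ?_
      simp
    have := hx.isAlgebraic
    have h := Algebra.IsAlgebraic.cardinalMk_le_max (Algebra.adjoin ℚ (Set.range x)) ℝ
    rw [Cardinal.mk_real, max_eq_right (Cardinal.mk_le_aleph0_iff.2 ‹_›)] at h
    exact absurd h (not_le.2 Cardinal.aleph0_lt_continuum)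
  exact ⟨x ∘ (Infinite.natEmbedding ι ∘ Fin.val),
    hx.1.comp _ ((Infinite.natEmbedding ι).injective.comp Fin.val_injective)⟩

/-- Rational translations preserve algebraic independence and move each coordinate into any open
interval. -/
theorem exists_algebraicIndependent_mem_Ioo {m : ℕ} (a b : Fin m → ℝ) (hab : ∀ i, a i < b i) :
    ∃ α : Fin m → ℝ, AlgebraicIndependent ℚ α ∧ ∀ i, a i < α i ∧ α i < b i := by
  obtain ⟨x, hx⟩ := exists_algebraicIndependent_real m
  have hq : ∀ i, ∃ q : ℚ, a i - x i < q ∧ (q : ℝ) < b i - x i := fun i =>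
    exists_rat_btwn (by linarith [hab i])
  choose q hq using hq
  refine ⟨fun i => Polynomial.aeval (x i) (Polynomial.X + Polynomial.C (q i)),
    hx.polynomial_aeval_of_transcendental fun i => ?_, fun i => ?_⟩
  · exact Polynomial.transcendental _ (by simp) (by simp [Polynomial.leadingCoeff_X_add_C])
  · simp only [map_add, Polynomial.aeval_X, Polynomial.aeval_C, eq_ratCast]
    constructor <;> linarith [(hq i).1, (hq i).2]

/-! ### Bases adapted to coordinates -/

theorem Submodule.exists_pivot_family {K ι : Type*} [Field K] [Fintype ι] [DecidableEq ι]
    (W : Submodule K (ι → K)) :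
    ∃ (J : Finset ι) (h : ι → ι → K), (∀ i ∈ J, h i ∈ W) ∧
      (∀ i ∈ J, ∀ j ∈ J, h i j = if i = j then 1 else 0) ∧
      ∀ z ∈ W, z = ∑ i ∈ J, z i • h i := by
  classical
  -- The pivots are a minimal set of coordinates that determines the elements of `W`. Dropping `i`
  -- from it leaves a nonzero vector of `W` supported, among the pivots, only at `i`.
  let p : Finset ι → Prop := fun J => ∀ z ∈ W, (∀ j ∈ J, z j = 0) → z = 0
  have hp : p Finset.univ := fun z _ h => funext fun i => h i (Finset.mem_univ i)
  obtain ⟨J, -, hJ⟩ := exists_minimal_le_of_wellFoundedLT p Finset.univ hp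
  have key : ∀ i : ι, ∃ h : ι → K, i ∈ J →
      h ∈ W ∧ ∀ j ∈ J, h j = if i = j then 1 else 0 := by
    intro i
    by_cases hi : i ∈ J
    · have hn : ¬ p (J.erase i) := fun hq =>
        (Finset.notMem_erase i J) (hJ.2 hq (Finset.erase_subset i J) hi)
      simp only [p, not_forall] at hn
      obtain ⟨z, hzW, hz, hz0⟩ := hn
      have hzi : z i ≠ 0 := fun h0 => hz0 <| hJ.1 z hzW fun j hj => by
        by_cases hji : j = i
        · exact hji ▸ h0
        · exact hz j (Finset.mem_erase.2 ⟨hji, hj⟩)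
      refine ⟨(z i)⁻¹ • z, fun _ => ⟨W.smul_mem _ hzW, fun j hj => ?_⟩⟩
      by_cases hij : i = j
      · subst hij; simp [hzi]
      · simp [hij, hz j (Finset.mem_erase.2 ⟨Ne.symm hij, hj⟩)]
    · exact ⟨0, fun h => absurd h hi⟩
  choose h hh using key
  refine ⟨J, h, fun i hi => (hh i hi).1, fun i hi => (hh i hi).2, fun z hz => ?_⟩
  rw [← sub_eq_zero]
  refine hJ.1 _ (W.sub_mem hz (W.sum_mem fun i hi => W.smul_mem _ (hh i hi).1)) fun j hj => ?_
  simp only [Pi.sub_apply, Finset.sum_apply, Pi.smul_apply, smul_eq_mul]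
  rw [Finset.sum_eq_single j, (hh j hj).2 j hj]
  · simp
  · intro i hi hij
    rw [(hh i hi).2 j hj, if_neg hij, mul_zero]
  · exact fun h => absurd hj h

/-- A homogeneous linear system over a subfield that has a solution on which some linear form over
the subfield does not vanish has such a solution over the subfield. -/
theorem exists_subfield_solution {F E ι κ : Type*} [Field F] [Field E] [Algebra F E]
    (J : Finset ι) (Z : Set κ) (c : ι → E) (a : ι → κ → F) (q : ι → F)
    (h0 : ∀ k ∈ Z, ∑ i ∈ J, c i * algebraMap F E (a i k) = 0)
    (hq : ∑ i ∈ J, c i * algebraMap F E (q i) ≠ 0) :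
    ∃ c' : ι → F, (∀ k ∈ Z, ∑ i ∈ J, c' i * a i k = 0) ∧ ∑ i ∈ J, c' i * q i ≠ 0 := by
  -- An `F`-linear functional applied to each `c i` preserves all equations with coefficients in
  -- `F`; it is chosen not to kill the value of the form.
  obtain ⟨f, hf⟩ := Module.Projective.exists_dual_ne_zero F hq
  have hmap : ∀ b : ι → F, f (∑ i ∈ J, c i * algebraMap F E (b i)) = ∑ i ∈ J, f (c i) * b i := by
    intro b
    rw [map_sum]
    refine Finset.sum_congr rfl fun i _ => ?_
    rw [mul_comm, ← Algebra.smul_def, map_smul, smul_eq_mul, mul_comm]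
  refine ⟨fun i => f (c i), fun k hk => ?_, ?_⟩
  · rw [← hmap fun i => a i k, h0 k hk, map_zero]
  · rwa [hmap] at hf

/-! ### Nonnegative factorizations of distance matrices -/

theorem quadratic_coeffs_eq_zero {a b c p q s : ℝ} (hab : a ≠ b) (hac : a ≠ c) (hbc : b ≠ c)
    (ha : p * a ^ 2 + q * a + s = 0) (hb : p * b ^ 2 + q * b + s = 0)
    (hc : p * c ^ 2 + q * c + s = 0) : p = 0 := by
  have h1 : (a - b) * (a - c) * (b - c) * p = 0 := by
    linear_combination (b - c) * ha - (a - c) * hb + (a - b) * hc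
  have h2 : (a - b) * (a - c) * (b - c) ≠ 0 :=
    mul_ne_zero (mul_ne_zero (sub_ne_zero.2 hab) (sub_ne_zero.2 hac)) (sub_ne_zero.2 hbc)
  exact (mul_eq_zero.1 h1).resolve_left h2

/-- The number of terms of a factorization of a generic squared distance matrix whose supports are
disjoint on the diagonal, as is the case for nonnegative ones. -/
theorem four_mul_le_sq_of_sq_dist_factorization {m r : ℕ} (hm : 3 ≤ m) {α : Fin m → ℝ}
    (hα : AlgebraicIndependent ℚ α) (U V : Fin m → Fin r → ℝ)
    (hUV : ∀ x y, ∑ k, U x k * V y k = (α x - α y) ^ 2) (hdiag : ∀ x k, U x k * V x k = 0) :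
    4 * m ≤ (r + 2) ^ 2 := by
  have hinj := hα.injective
  set W := Submodule.span ℝ (Set.range U)
  -- Pairing with `V y` turns each vector of `W` into a polynomial of degree at most 2 evaluated at
  -- `α y`.
  have hquad : ∀ z ∈ W, ∃ q : Fin 3 → ℝ,
      ∀ y, ∑ k, z k * V y k = q 0 * α y ^ 2 + q 1 * α y + q 2 := by
    intro z hz
    induction hz using Submodule.span_induction with
    | mem z hz =>
      obtain ⟨x, rfl⟩ := hz
      refine ⟨![1, -2 * α x, α x ^ 2], fun y => ?_⟩
      rw [hUV]
      simp
      ring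
    | zero => exact ⟨0, by simp⟩
    | add z w _ _ hz hw =>
      obtain ⟨q, hq⟩ := hz
      obtain ⟨q', hq'⟩ := hw
      refine ⟨q + q', fun y => ?_⟩
      simp only [Pi.add_apply, add_mul, Finset.sum_add_distrib, hq, hq']
      ring
    | smul t z _ hz =>
      obtain ⟨q, hq⟩ := hz
      refine ⟨t • q, fun y => ?_⟩
      simp only [Pi.smul_apply, smul_eq_mul, mul_assoc, ← Finset.mul_sum, hq]
      ring
  obtain ⟨J, h, hJW, hJ, hJspan⟩ := W.exists_pivot_family
  have hq : ∀ i, ∃ q : Fin 3 → ℝ, i ∈ J →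
      ∀ y, ∑ k, h i k * V y k = q 0 * α y ^ 2 + q 1 * α y + q 2 := by
    intro i
    by_cases hi : i ∈ J
    · obtain ⟨q, hq⟩ := hquad _ (hJW i hi)
      exact ⟨q, fun _ => hq⟩
    · exact ⟨0, fun h => absurd h hi⟩
  choose q hq using hq
  -- Normalizing the leading coefficient to 0 or 1 saves one parameter per basis vector.
  have hscale : ∀ i, ∃ s : ℝ, s ≠ 0 ∧ (s * q i 0 = 0 ∨ s * q i 0 = 1) := fun i => by
    by_cases h : q i 0 = 0
    · exact ⟨1, one_ne_zero, Or.inl (by simp [h])⟩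
    · exact ⟨(q i 0)⁻¹, inv_ne_zero h, Or.inr (inv_mul_cancel₀ h)⟩
  choose s hs hst using hscale
  -- The parameters: for each pivot, the `r - d` nonpivot entries and the two lower coefficients.
  let g : J × ((Jᶜ : Finset (Fin r)) ⊕ Fin 2) → ℝ := fun p =>
    Sum.elim (fun k => s p.1 * h p.1 k.1) (fun e => s p.1 * q p.1 e.succ) p.2
  set F := IntermediateField.adjoin ℚ (Set.range g)
  have hmem : ∀ p, g p ∈ F := fun p => IntermediateField.subset_adjoin _ _ ⟨p, rfl⟩
  have hqF : ∀ i j, ∃ f : F, i ∈ J → (f : ℝ) = s i * q i j := by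
    intro i j
    by_cases hi : i ∈ J
    · induction j using Fin.cases with
      | zero =>
        rcases hst i with h0 | h1
        · exact ⟨0, fun _ => by simp [h0]⟩
        · exact ⟨1, fun _ => by simp [h1]⟩
      | succ e => exact ⟨⟨_, hmem (⟨i, hi⟩, Sum.inr e)⟩, fun _ => rfl⟩
    · exact ⟨0, fun h => absurd h hi⟩
  -- At a pivot the true entry is `s i` or 0, and `s i` need not lie in `F`. Replacing it by 1 is
  -- harmless, since only the vanishing of pivot coordinates is used.
  have haF : ∀ i k, ∃ f : F, i ∈ J →
      (f : ℝ) = if k ∈ J then (if i = k then 1 else 0) else s i * h i k := by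
    intro i k
    by_cases hi : i ∈ J
    · by_cases hk : k ∈ J
      · by_cases hik : i = k
        · exact ⟨1, fun _ => by simp [hk, hik]⟩
        · exact ⟨0, fun _ => by simp [hk, hik]⟩
      · exact ⟨⟨_, hmem (⟨i, hi⟩, Sum.inl ⟨k, Finset.mem_compl.2 hk⟩)⟩, fun _ => by
          rw [if_neg hk]; rfl⟩
    · exact ⟨0, fun h => absurd h hi⟩
  choose Q hQ using hqF
  choose a ha using haF
  have hvals : ∀ (c : Fin r → ℝ) (y : Fin m),
      ∑ k, (∑ i ∈ J, c i * (s i * h i k)) * V y k =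
        (∑ i ∈ J, c i * (Q i 0 : ℝ)) * α y ^ 2 + (∑ i ∈ J, c i * (Q i 1 : ℝ)) * α y
          + ∑ i ∈ J, c i * (Q i 2 : ℝ) := by
    intro c y
    simp_rw [Finset.sum_mul]
    rw [Finset.sum_comm, ← Finset.sum_add_distrib, ← Finset.sum_add_distrib]
    refine Finset.sum_congr rfl fun i hi => ?_
    rw [hQ i 0 hi, hQ i 1 hi, hQ i 2 hi]
    simp_rw [mul_assoc]
    rw [← Finset.mul_sum, ← Finset.mul_sum, hq i hi y]
    ring
  have halg : ∀ x, IsAlgebraic F (α x) := by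
    intro x
    have hUx : ∀ k, U x k = ∑ i ∈ J, (U x i / s i) * (s i * h i k) := by
      intro k
      have h1 := congrFun (hJspan (U x) (Submodule.subset_span ⟨x, rfl⟩)) k
      rw [h1, Finset.sum_apply]
      refine Finset.sum_congr rfl fun i _ => ?_
      rw [Pi.smul_apply, smul_eq_mul]
      field_simp [hs i]
    have hzero : ∀ k ∈ {k | V x k ≠ 0}, U x k = 0 := fun k hk =>
      (mul_eq_zero.1 (hdiag x k)).resolve_right hk
    -- Three distinct points determine the quadratic induced by `U x`; this is where `3 ≤ m` enters.
    have hlead : ∑ i ∈ J, (U x i / s i) * algebraMap F ℝ (Q i 0) = 1 := by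
      have hpt : ∀ y, (∑ i ∈ J, (U x i / s i) * (Q i 0 : ℝ) - 1) * α y ^ 2
          + (∑ i ∈ J, (U x i / s i) * (Q i 1 : ℝ) + 2 * α x) * α y
          + (∑ i ∈ J, (U x i / s i) * (Q i 2 : ℝ) - α x ^ 2) = 0 := by
        intro y
        have h1 := hvals (fun i => U x i / s i) y
        simp_rw [← hUx, hUV] at h1
        linear_combination -h1
      have hne : ∀ i j : Fin 3, i ≠ j →
          α (Fin.castLE hm i) ≠ α (Fin.castLE hm j) := fun i j hij h =>
        hij (Fin.castLE_injective hm (hinj h))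
      exact sub_eq_zero.1 (quadratic_coeffs_eq_zero (hne 0 1 (by decide)) (hne 0 2 (by decide))
        (hne 1 2 (by decide)) (hpt _) (hpt _) (hpt _))
    have hsys : ∀ k ∈ {k | V x k ≠ 0},
        ∑ i ∈ J, (U x i / s i) * algebraMap F ℝ (a i k) = 0 := by
      intro k hk
      by_cases hkJ : k ∈ J
      · rw [Finset.sum_eq_single k]
        · rw [hzero k hk, zero_div, zero_mul]
        · intro i hi hik
          change _ * (a i k : ℝ) = 0
          rw [ha i k hi, if_pos hkJ, if_neg hik, mul_zero]
        · exact fun h => absurd hkJ h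
      · rw [← hzero k hk, hUx k]
        refine Finset.sum_congr rfl fun i hi => ?_
        change _ * (a i k : ℝ) = _
        rw [ha i k hi, if_neg hkJ]
    -- `U x` vanishes on the support of `V x` and has nonzero leading coefficient. Some combination
    -- with coefficients in `F` does too; it is orthogonal to `V x`, so its quadratic vanishes at `α
    -- x`.
    obtain ⟨c, hc0, hc⟩ := exists_subfield_solution J {k | V x k ≠ 0} (fun i => U x i / s i) a
      (fun i => Q i 0) hsys (by rw [hlead]; exact one_ne_zero)
    have hvanish : ∀ k, V x k ≠ 0 → ∑ i ∈ J, (c i : ℝ) * (s i * h i k) = 0 := by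
      intro k hk
      have h1 : ∑ i ∈ J, (c i : ℝ) * (a i k : ℝ) = 0 := by
        have := congrArg (algebraMap F ℝ) (hc0 k hk)
        rwa [map_sum, map_zero, Finset.sum_congr rfl fun i _ => map_mul _ _ _] at this
      by_cases hkJ : k ∈ J
      · rw [Finset.sum_eq_single k] at h1 ⊢
        · rw [ha k k hkJ, if_pos hkJ, if_pos rfl, mul_one] at h1
          rw [h1, zero_mul]
        · intro i hi hik
          rw [hJ i hi k hkJ, if_neg hik, mul_zero, mul_zero]
        · exact fun h => absurd hkJ h
        · intro i hi hik
          rw [ha i k hi, if_pos hkJ, if_neg hik, mul_zero]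
        · exact fun h => absurd hkJ h
      · rw [← h1]
        refine Finset.sum_congr rfl fun i hi => ?_
        rw [ha i k hi, if_neg hkJ]
    have hroot := hvals (fun i => (c i : ℝ)) x
    rw [Finset.sum_eq_zero] at hroot
    · refine ⟨Polynomial.C (∑ i ∈ J, c i * Q i 0) * Polynomial.X ^ 2
        + Polynomial.C (∑ i ∈ J, c i * Q i 1) * Polynomial.X
        + Polynomial.C (∑ i ∈ J, c i * Q i 2), fun h0 => hc ?_, ?_⟩
      · have := congrArg (fun P => Polynomial.coeff P 2) h0
        simpa [-map_sum, Polynomial.coeff_X, Polynomial.coeff_C] using this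
      · simp only [map_add, map_mul, map_pow, Polynomial.aeval_X, Polynomial.aeval_C, map_sum]
        exact hroot.symm
    · intro k _
      by_cases hk : V x k = 0
      · rw [hk, mul_zero]
      · rw [hvanish k hk, zero_mul]
  have hcard := card_le_of_isAlgebraic_adjoin hα g halg
  simp only [Fintype.card_prod, Fintype.card_sum, Fintype.card_coe, Fintype.card_fin,
    Finset.card_compl] at hcard
  have hle : J.card ≤ r := by simpa using Finset.card_le_univ J
  generalize J.card = d at hcard hle
  obtain ⟨e, rfl⟩ := Nat.exists_eq_add_of_le hle
  rw [Nat.add_sub_cancel_left] at hcard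
  zify at hcard ⊢
  nlinarith [sq_nonneg ((d : ℤ) - (e + 2))]

/-- A rescaled matrix of squared distances of points of the line. -/
def IsScaledSqDist {m : ℕ} (α : Fin m → ℝ) (M : Matrix (Fin m) (Fin m) ℝ) : Prop :=
  ∃ l r : Fin m → ℝ, (∀ x, 0 < l x) ∧ (∀ y, 0 < r y) ∧
    ∀ x y, M x y = l x * r y * (α x - α y) ^ 2

theorem IsScaledSqDist.le_of_factorization {m n : ℕ} {α : Fin m → ℝ} (hm : 2 ≤ m)
    (hα : AlgebraicIndependent ℚ α) {M : Matrix (Fin m) (Fin m) ℝ} (hM : IsScaledSqDist α M)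
    {u v : Fin n → Fin m → ℝ} (hu : ∀ k x, 0 ≤ u k x) (hv : ∀ k y, 0 ≤ v k y)
    (huv : ∀ x y, M x y = ∑ k, u k x * v k y) : 2 * √(m : ℝ) - 2 ≤ n := by
  obtain ⟨l, r, hl, hr, hM⟩ := hM
  have key : 4 * m ≤ (n + 2) ^ 2 := by
    rcases hm.lt_or_eq with hm | rfl
    · refine four_mul_le_sq_of_sq_dist_factorization hm hα (fun x k => u k x / l x)
        (fun y k => v k y / r y) (fun x y => ?_) (fun x k => ?_)
      · have h1 := huv x y
        rw [hM] at h1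
        have : ∀ k, u k x / l x * (v k y / r y) = (u k x * v k y) / (l x * r y) := fun k => by
          rw [div_mul_div_comm]
        simp_rw [this, ← Finset.sum_div, ← h1]
        field_simp [(hl x).ne', (hr y).ne']
      · have h1 := huv x x
        rw [hM, sub_self] at h1
        have h2 := (Finset.sum_eq_zero_iff_of_nonneg fun k _ =>
          mul_nonneg (hu k x) (hv k x)).1 (by rw [← h1]; ring) k (Finset.mem_univ k)
        rw [div_mul_div_comm, h2, zero_div]
    -- For two points, `n ≥ 1` suffices because `4 * 2 ≤ 3 ^ 2`.
    · have hn : n ≠ 0 := by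
        rintro rfl
        have h1 := huv 0 1
        rw [hM] at h1
        have h2 : α 0 - α 1 ≠ 0 := sub_ne_zero.2 fun h => by simpa using hα.injective h
        have : 0 < l 0 * r 1 * (α 0 - α 1) ^ 2 := by
          have := hl 0; have := hr 1; positivity
        rw [h1] at this
        simp at this
      have : 1 ≤ n := Nat.one_le_iff_ne_zero.2 hn
      nlinarith
  have h1 : (4 : ℝ) * m ≤ (n + 2) ^ 2 := by exact_mod_cast key
  have h2 : √(m : ℝ) ≤ ((n : ℝ) + 2) / 2 := Real.sqrt_le_iff.2 ⟨by positivity, by nlinarith⟩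
  linarith

theorem IsScaledSqDist.le_nonnegRank {m : ℕ} {α : Fin m → ℝ} (hm : 2 ≤ m)
    (hα : AlgebraicIndependent ℚ α) {M : Matrix (Fin m) (Fin m) ℝ} (hM : IsScaledSqDist α M) :
    2 * √(m : ℝ) - 2 ≤ nonnegRank M := by
  -- The infimum of the empty set is 0, so some factorization must be exhibited.
  have hne : {n : ℕ | ∃ u v : Fin n → Fin m → ℝ, (∀ k x, 0 ≤ u k x) ∧ (∀ k y, 0 ≤ v k y) ∧
      ∀ x y, M x y = ∑ k, u k x * v k y}.Nonempty := by
    obtain ⟨l, r, hl, hr, hM⟩ := hM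
    refine ⟨m, fun k x => if k = x then 1 else 0, M, fun k x => by positivity,
      fun k y => ?_, fun x y => by simp⟩
    rw [hM]
    have := hl k; have := hr y; positivity
  obtain ⟨u, v, hu, hv, huv⟩ := Nat.sInf_mem hne
  exact hM.le_of_factorization hm hα hu hv huv

theorem IsScaledSqDist.psdRank_eq_two {m : ℕ} {α : Fin m → ℝ} (hm : 2 ≤ m)
    (hα : Function.Injective α) {M : Matrix (Fin m) (Fin m) ℝ} (hM : IsScaledSqDist α M) :
    psdRank M = 2 := by
  obtain ⟨l, r, hl, hr, hM⟩ := hM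
  refine le_antisymm (Nat.sInf_le ?_) (le_csInf ⟨2, ?_⟩ ?_)
  rotate_right
  · rintro n ⟨C, D, -, -, hCD⟩
    by_contra hn
    have hpos : ∀ x y, x ≠ y → M x y ≠ 0 := fun x y hxy => by
      rw [hM]
      exact mul_ne_zero (mul_pos (hl x) (hr y)).ne'
        (pow_ne_zero 2 (sub_ne_zero.2 fun h => hxy (hα h)))
    have h01 : (⟨0, by lia⟩ : Fin m) ≠ ⟨1, by lia⟩ := by simp
    have hn : n = 0 ∨ n = 1 := by lia
    rcases hn with rfl | rfl
    · refine hpos _ _ h01 ?_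
      have := hCD ⟨0, by lia⟩ ⟨1, by lia⟩
      simpa [Matrix.trace] using this
    -- In size 1 the zero diagonal entry kills one scalar factor, and with it an off-diagonal entry.
    · have h1 := hCD ⟨0, by lia⟩ ⟨0, by lia⟩
      have h2 := hCD ⟨0, by lia⟩ ⟨1, by lia⟩
      have h3 := hCD ⟨1, by lia⟩ ⟨0, by lia⟩
      have h4 : M ⟨0, by lia⟩ ⟨0, by lia⟩ = 0 := by rw [hM]; simp
      simp only [Matrix.trace, Matrix.diag, Matrix.mul_apply, Finset.univ_unique,
        Finset.sum_singleton] at h1 h2 h3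
      rw [h4, Complex.ofReal_zero] at h1
      rcases mul_eq_zero.1 h1.symm with h | h
      · rw [h, zero_mul] at h2
        exact hpos _ _ h01 (Complex.ofReal_eq_zero.1 h2)
      · rw [h, mul_zero] at h3
        exact hpos _ _ h01.symm (Complex.ofReal_eq_zero.1 h3)
  all_goals
    refine ⟨fun x => (l x : ℂ) • Matrix.vecMulVec ![1, (α x : ℂ)] (star ![1, (α x : ℂ)]),
      fun y => (r y : ℂ) • Matrix.vecMulVec ![(α y : ℂ), -1] (star ![(α y : ℂ), -1]),
      fun x => (Matrix.posSemidef_vecMulVec_self_star _).smul (by exact_mod_cast (hl x).le),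
      fun y => (Matrix.posSemidef_vecMulVec_self_star _).smul (by exact_mod_cast (hr y).le),
      fun x y => ?_⟩
    rw [hM]
    simp only [Matrix.trace, Matrix.diag, Matrix.mul_apply, Fin.sum_univ_two, Matrix.smul_apply,
      Matrix.vecMulVec_apply, Pi.star_apply]
    simp
    ring

/-! ### Schmidt vectors of an entangled state -/

/-- The coefficient matrix of a bipartite vector. -/
def coeffMatrix {a b : ℕ} (ψ : EuclideanSpace ℂ (Fin a × Fin b)) : Matrix (Fin a) (Fin b) ℂ :=
  Matrix.of fun i j => ψ (i, j)

theorem exists_unitary_mul_orthogonal_rows {a b : ℕ} (Ψ : Matrix (Fin a) (Fin b) ℂ) :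
    ∃ (U : Matrix (Fin a) (Fin a) ℂ) (G : Matrix (Fin a) (Fin b) ℂ) (lam : Fin a → ℝ),
      Uᴴ * U = 1 ∧ Ψ = U * G ∧ G * Gᴴ = Matrix.diagonal fun i => (lam i : ℂ) := by
  have hH : (Ψ * Ψᴴ).IsHermitian := Matrix.isHermitian_mul_conjTranspose_self Ψ
  let U : Matrix (Fin a) (Fin a) ℂ := (hH.eigenvectorUnitary).1
  have hUU : Uᴴ * U = 1 := Unitary.coe_star_mul_self _
  have hUU' : U * Uᴴ = 1 := Unitary.coe_mul_star_self _
  refine ⟨U, Uᴴ * Ψ, hH.eigenvalues, hUU, ?_, ?_⟩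
  · rw [← Matrix.mul_assoc, hUU', Matrix.one_mul]
  · have hspec : Ψ * Ψᴴ = U * Matrix.diagonal (fun i => (hH.eigenvalues i : ℂ)) * Uᴴ := by
      have := hH.spectral_theorem
      rw [Unitary.conjStarAlgAut_apply] at this
      exact this
    calc Uᴴ * Ψ * (Uᴴ * Ψ)ᴴ = Uᴴ * (Ψ * Ψᴴ) * U := by
          simp only [Matrix.conjTranspose_mul, Matrix.conjTranspose_conjTranspose, Matrix.mul_assoc]
      _ = (Uᴴ * U) * Matrix.diagonal (fun i => (hH.eigenvalues i : ℂ)) * (Uᴴ * U) := by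
          refine (congrArg (fun A => Uᴴ * A * U) hspec).trans ?_
          simp only [Matrix.mul_assoc]
      _ = _ := by rw [hUU, Matrix.one_mul, Matrix.mul_one]

/-- `N` and `Yᵀ` are isometries of `ℂ²` that intertwine `Ψ` with `diag s`. -/
structure IsSchmidtPair {a b : ℕ} (Ψ : Matrix (Fin a) (Fin b) ℂ) (N : Matrix (Fin a) (Fin 2) ℂ)
    (Y : Matrix (Fin 2) (Fin b) ℂ) (s : Fin 2 → ℝ) : Prop where
  left_isometry : Nᴴ * N = 1
  right_isometry : Y * Yᴴ = 1
  left_eq : Nᴴ * Ψ = Matrix.diagonal (fun i => (s i : ℂ)) * Y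
  right_eq : Ψ * Yᴴ = N * Matrix.diagonal (fun i => (s i : ℂ))

theorem exists_isSchmidtPair {a b : ℕ} {ψ : EuclideanSpace ℂ (Fin a × Fin b)}
    (hψ : IsEntangled ψ) :
    ∃ N Y s, (∀ i, 0 < s i) ∧ IsSchmidtPair (coeffMatrix ψ) N Y s := by
  obtain ⟨U, G, lam, hU, hΨ, hG⟩ := exists_unitary_mul_orthogonal_rows (coeffMatrix ψ)
  have hdiag : ∀ i, ((∑ j, ‖G i j‖ ^ 2 : ℝ) : ℂ) = lam i := fun i => by
    have := congrFun (congrFun hG i) i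
    rw [Matrix.diagonal_apply_eq, Matrix.mul_apply] at this
    rw [← this]
    push_cast
    refine Finset.sum_congr rfl fun j _ => ?_
    rw [Matrix.conjTranspose_apply]
    exact (Complex.mul_conj' _).symm
  have hlam : ∀ i, lam i = ∑ j, ‖G i j‖ ^ 2 := fun i => by exact_mod_cast (hdiag i).symm
  have hpos : ∀ i j, G i j ≠ 0 → 0 < lam i := fun i j hij => by
    rw [hlam]
    exact Finset.sum_pos' (fun _ _ => by positivity) ⟨j, Finset.mem_univ j, by positivity⟩
  -- With at most one nonzero row in `G`, the coefficient matrix has rank at most one and `ψ` is a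
  -- product.
  have htwo : ∃ k l, k ≠ l ∧ 0 < lam k ∧ 0 < lam l := by
    by_contra hcon
    push Not at hcon
    apply hψ
    by_cases hex : ∃ k, 0 < lam k
    · obtain ⟨k, hk⟩ := hex
      refine ⟨fun i => U i k, G k, fun i j => ?_⟩
      have h1 := congrFun (congrFun hΨ i) j
      rw [Matrix.mul_apply, Finset.sum_eq_single k] at h1
      · exact h1
      · intro l _ hl
        have : G l j = 0 := by
          by_contra h0
          exact absurd (hpos l j h0) (not_lt.2 (hcon k l hl.symm hk))
        rw [this, mul_zero]
      · simp
    · refine ⟨0, 0, fun i j => ?_⟩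
      have h1 := congrFun (congrFun hΨ i) j
      rw [Matrix.mul_apply, Finset.sum_eq_zero] at h1
      · rw [Pi.zero_apply, zero_mul]
        exact h1
      · intro l _
        have : G l j = 0 := by
          by_contra h0
          exact hex ⟨l, hpos l j h0⟩
        rw [this, mul_zero]
  obtain ⟨k, l, hkl, hk, hl⟩ := htwo
  let f : Fin 2 → Fin a := ![k, l]
  have hf : Function.Injective f := by
    intro i j hij
    fin_cases i <;> fin_cases j <;> simp_all [f]
  have hfpos : ∀ i, 0 < lam (f i) := by
    intro i; fin_cases i <;> simpa [f]
  let s : Fin 2 → ℝ := fun i => √(lam (f i))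
  have hs : ∀ i, 0 < s i := fun i => Real.sqrt_pos.2 (hfpos i)
  let D : Matrix (Fin 2) (Fin 2) ℂ := Matrix.diagonal fun i => (s i : ℂ)
  let D' : Matrix (Fin 2) (Fin 2) ℂ := Matrix.diagonal fun i => ((s i)⁻¹ : ℂ)
  have hne : ∀ i, (s i : ℂ) ≠ 0 := fun i => by exact_mod_cast (hs i).ne'
  have hDD' : D * D' = 1 := by
    simp [D, D', Matrix.diagonal_mul_diagonal, hne]
  have hD'D : D' * D = 1 := by
    simp [D, D', Matrix.diagonal_mul_diagonal, hne]
  have hD'H : D'ᴴ = D' := by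
    simp only [D', Matrix.diagonal_conjTranspose]
    congr 1
    ext i
    simp
  have hsub : (G.submatrix f id) * (G.submatrix f id)ᴴ = D * D := by
    rw [Matrix.conjTranspose_submatrix]
    have h1 : G.submatrix f id * Gᴴ.submatrix id f = (G * Gᴴ).submatrix f f :=
      Matrix.submatrix_mul_equiv G Gᴴ f (Equiv.refl _) f
    rw [h1, hG, Matrix.submatrix_diagonal _ _ hf, Matrix.diagonal_mul_diagonal]
    congr 1
    ext i
    simp only [Function.comp, s]
    rw [← Complex.ofReal_mul, Real.mul_self_sqrt (hfpos i).le]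
  have hleft : (U.submatrix id f)ᴴ * coeffMatrix ψ = G.submatrix f id := by
    rw [Matrix.conjTranspose_submatrix]
    have h1 : Uᴴ * coeffMatrix ψ = G := by rw [hΨ, ← Matrix.mul_assoc, hU, Matrix.one_mul]
    conv_rhs => rw [← h1]
    exact Matrix.submatrix_mul_equiv Uᴴ (coeffMatrix ψ) f (Equiv.refl _) id
  refine ⟨U.submatrix id f, D' * G.submatrix f id, s, hs, ?_, ?_, ?_, ?_⟩
  · rw [Matrix.conjTranspose_submatrix]
    have h1 : Uᴴ.submatrix f id * U.submatrix id f = (Uᴴ * U).submatrix f f :=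
      Matrix.submatrix_mul_equiv Uᴴ U f (Equiv.refl _) f
    rw [h1, hU, Matrix.submatrix_one _ hf]
  · rw [Matrix.conjTranspose_mul, hD'H, Matrix.mul_assoc, ← Matrix.mul_assoc _ _ D', hsub,
      Matrix.mul_assoc, hDD', Matrix.mul_one, hD'D]
  · change _ = D * (D' * G.submatrix f id)
    rw [hleft, ← Matrix.mul_assoc, hDD', Matrix.one_mul]
  · rw [Matrix.conjTranspose_mul, hD'H]
    have h1 : coeffMatrix ψ * (G.submatrix f id)ᴴ = U.submatrix id f * (D * D) := by
      rw [Matrix.conjTranspose_submatrix]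
      have h2 : coeffMatrix ψ * Gᴴ.submatrix id f = (coeffMatrix ψ * Gᴴ).submatrix id f :=
        Matrix.submatrix_mul_equiv (coeffMatrix ψ) Gᴴ id (Equiv.refl _) f
      rw [h2, hΨ, Matrix.mul_assoc, hG]
      ext i j
      rw [Matrix.submatrix_apply, Matrix.mul_diagonal, Matrix.diagonal_mul_diagonal,
        Matrix.mul_diagonal, Matrix.submatrix_apply, ← Complex.ofReal_mul,
        Real.mul_self_sqrt (hfpos j).le]
    rw [← Matrix.mul_assoc, h1, Matrix.mul_assoc, Matrix.mul_assoc, hDD', Matrix.mul_one]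

/-! ### Measurements of a pure state -/

theorem noise_zero {a b : ℕ} (ρ : BiMatrix a b) : noise 0 ρ = ρ := by
  simp [noise, noiseLeft, noiseRight]

theorem trace_kronecker_mul_pureState {a b : ℕ} (ψ : EuclideanSpace ℂ (Fin a × Fin b))
    (E : Matrix (Fin a) (Fin a) ℂ) (F : Matrix (Fin b) (Fin b) ℂ) :
    ((E ⊗ₖ F) * pureState ψ).trace = (E * coeffMatrix ψ * Fᵀ * (coeffMatrix ψ)ᴴ).trace := by
  simp only [Matrix.trace, Matrix.diag, Matrix.mul_apply, Fintype.sum_prod_type,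
    Matrix.kroneckerMap_apply, pureState, Matrix.of_apply, coeffMatrix, Matrix.transpose_apply,
    Matrix.conjTranspose_apply, Finset.sum_mul]
  refine Finset.sum_congr rfl fun i _ => Finset.sum_congr rfl fun j _ => ?_
  rw [Finset.sum_comm]
  refine Finset.sum_congr rfl fun k _ => Finset.sum_congr rfl fun l _ => ?_
  ring

theorem trace_coeffMatrix {a b : ℕ} {ψ : EuclideanSpace ℂ (Fin a × Fin b)} (hψ : ‖ψ‖ = 1) :
    (coeffMatrix ψ * (coeffMatrix ψ)ᴴ).trace = 1 := by
  have h1 : ∑ s, ‖ψ s‖ ^ 2 = 1 := by rw [← EuclideanSpace.norm_sq_eq, hψ, one_pow]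
  have h2 : ((∑ s, ‖ψ s‖ ^ 2 : ℝ) : ℂ) = 1 := by rw [h1, Complex.ofReal_one]
  rw [← h2, Fintype.sum_prod_type]
  push_cast
  simp only [Matrix.trace, Matrix.diag, Matrix.mul_apply, Matrix.conjTranspose_apply]
  exact Finset.sum_congr rfl fun i _ => Finset.sum_congr rfl fun j _ => Complex.mul_conj' _

theorem isState_pureState {a b : ℕ} {ψ : EuclideanSpace ℂ (Fin a × Fin b)} (hψ : ‖ψ‖ = 1) :
    IsState (pureState ψ) := by
  refine ⟨Matrix.posSemidef_vecMulVec_self_star (fun s => ψ s), ?_⟩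
  have h := trace_kronecker_mul_pureState ψ 1 1
  rwa [Matrix.one_kronecker_one, Matrix.one_mul, Matrix.one_mul, Matrix.transpose_one,
    Matrix.mul_one, trace_coeffMatrix hψ] at h

theorem Generates.isCorrelation {a b n : ℕ} {ψ : EuclideanSpace ℂ (Fin a × Fin b)} (hψ : ‖ψ‖ = 1)
    {P : Matrix (Fin n) (Fin n) ℝ} (hP : Generates 0 (pureState ψ) P) : IsCorrelation P := by
  obtain ⟨E, F, hE, hF, hP⟩ := hP
  simp_rw [noise_zero] at hP
  constructor
  · intro x y
    have h1 : (0 : ℂ) ≤ ((E x ⊗ₖ F y) * pureState ψ).trace := by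
      have h2 : pureState ψ = Matrix.vecMulVec (fun s => ψ s) (star fun s => ψ s) := rfl
      rw [h2, Matrix.mul_vecMulVec, Matrix.trace_vecMulVec, dotProduct_comm]
      exact ((hE.posSemidef x).kronecker (hF.posSemidef y)).dotProduct_mulVec_nonneg _
    rw [← hP] at h1
    exact_mod_cast h1
  · have h1 : ((∑ x, ∑ y, P x y : ℝ) : ℂ) = 1 := by
      push_cast
      simp_rw [hP]
      have h2 : ∀ x, ∑ y, ((E x ⊗ₖ F y) * pureState ψ).trace
          = ((E x ⊗ₖ 1) * pureState ψ).trace := fun x => by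
        rw [← Matrix.trace_sum, ← Finset.sum_mul, ← hF.sum_eq_one]
        congr 2
        ext s t
        simp [Matrix.sum_apply, Finset.mul_sum]
      simp_rw [h2]
      rw [← Matrix.trace_sum, ← Finset.sum_mul, ← (isState_pureState hψ).trace_eq_one]
      have h3 : ∑ x, E x ⊗ₖ (1 : Matrix (Fin b) (Fin b) ℂ) = 1 := by
        rw [← Matrix.one_kronecker_one, ← hE.sum_eq_one]
        ext s t
        simp [Matrix.sum_apply, Finset.sum_mul]
      rw [h3, Matrix.one_mul]
    exact_mod_cast h1

/-- Extend a measurement on `ℂ²`, embedded by `N`, by the projection onto the complement. -/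
def extendPOVM {n d : ℕ} (N : Matrix (Fin d) (Fin 2) ℂ) (T : Fin n → Matrix (Fin 2) (Fin 2) ℂ) :
    Fin (n + 1) → Matrix (Fin d) (Fin d) ℂ :=
  Fin.snoc (α := fun _ => Matrix (Fin d) (Fin d) ℂ) (fun x => N * T x * Nᴴ) (1 - N * Nᴴ)

theorem isPOVM_extendPOVM {n d : ℕ} {N : Matrix (Fin d) (Fin 2) ℂ} (hN : Nᴴ * N = 1)
    {T : Fin n → Matrix (Fin 2) (Fin 2) ℂ} (hT : IsPOVM T) : IsPOVM (extendPOVM N T) := by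
  constructor
  · intro x
    induction x using Fin.lastCases with
    | last =>
      have h1 : (1 - N * Nᴴ)ᴴ * (1 - N * Nᴴ) = 1 - N * Nᴴ := by
        have h2 : N * Nᴴ * (N * Nᴴ) = N * Nᴴ := by
          rw [Matrix.mul_assoc, ← Matrix.mul_assoc Nᴴ, hN, Matrix.one_mul]
        simp only [Matrix.conjTranspose_sub, Matrix.conjTranspose_one, Matrix.conjTranspose_mul,
          Matrix.conjTranspose_conjTranspose, Matrix.mul_sub, Matrix.sub_mul, Matrix.one_mul,
          Matrix.mul_one, h2]
        abel
      simp only [extendPOVM, Fin.snoc_last]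
      rw [← h1]
      exact Matrix.posSemidef_conjTranspose_mul_self _
    | cast x =>
      simp only [extendPOVM, Fin.snoc_castSucc]
      exact (hT.posSemidef x).mul_mul_conjTranspose_same N
  · rw [Fin.sum_univ_castSucc]
    simp only [extendPOVM, Fin.snoc_castSucc, Fin.snoc_last]
    rw [← Matrix.sum_mul, ← Matrix.mul_sum, hT.sum_eq_one, Matrix.mul_one, add_sub_cancel]

theorem addCorner_castSucc_castSucc {n : ℕ} (M : Matrix (Fin n) (Fin n) ℝ) (c : ℝ) (x y : Fin n) :
    addCorner M c x.castSucc y.castSucc = M x y := by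
  simp [addCorner]

theorem addCorner_last_last {n : ℕ} (M : Matrix (Fin n) (Fin n) ℝ) (c : ℝ) :
    addCorner M c (Fin.last n) (Fin.last n) = c := by
  simp [addCorner]

theorem generates_addCorner {a b n : ℕ} {ψ : EuclideanSpace ℂ (Fin a × Fin b)} (hψ : ‖ψ‖ = 1)
    {N Y s} (h : IsSchmidtPair (coeffMatrix ψ) N Y s) {T S : Fin n → Matrix (Fin 2) (Fin 2) ℂ}
    (hT : IsPOVM T) (hS : IsPOVM S) {M : Matrix (Fin n) (Fin n) ℝ}
    (hM : ∀ x y, (M x y : ℂ) = (T x * Matrix.diagonal (fun i => (s i : ℂ)) * (S y)ᵀ *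
      Matrix.diagonal (fun i => (s i : ℂ))).trace) :
    Generates 0 (pureState ψ) (addCorner M (1 - (s 0 ^ 2 + s 1 ^ 2))) := by
  obtain ⟨hN, hY, hl, hr⟩ := h
  set D : Matrix (Fin 2) (Fin 2) ℂ := Matrix.diagonal (fun i => (s i : ℂ)) with hD
  have hDH : Dᴴ = D := by
    rw [hD, Matrix.diagonal_conjTranspose]
    congr 1
    ext i
    simp
  have hYt : (Yᵀ)ᴴ * Yᵀ = 1 := by
    have h1 : (Yᵀ)ᴴ = (Yᴴ)ᵀ := rfl
    rw [h1, ← Matrix.transpose_mul, hY, Matrix.transpose_one]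
  have hYtt : ((Yᵀ)ᴴ)ᵀ = Yᴴ := rfl
  have hr' : Y * (coeffMatrix ψ)ᴴ = D * Nᴴ := by
    have := congrArg Matrix.conjTranspose hr
    rwa [Matrix.conjTranspose_mul, Matrix.conjTranspose_mul, Matrix.conjTranspose_conjTranspose,
      hDH] at this
  refine ⟨extendPOVM N T, extendPOVM Yᵀ S, isPOVM_extendPOVM hN hT, isPOVM_extendPOVM hYt hS, ?_⟩
  intro x y
  rw [noise_zero, trace_kronecker_mul_pureState]
  set Ψ := coeffMatrix ψ with hΨ
  induction x using Fin.lastCases with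
  | last =>
    -- `Ψ` maps the chosen right Schmidt vectors into the range of `N`, so one party never fails
    -- alone.
    have hzero : (1 - N * Nᴴ) * Ψ * Yᴴ = 0 := by
      rw [Matrix.mul_assoc, hr, Matrix.sub_mul, Matrix.mul_assoc, ← Matrix.mul_assoc Nᴴ, hN,
        Matrix.one_mul, Matrix.one_mul, sub_self]
    induction y using Fin.lastCases with
    | last =>
      simp only [extendPOVM, Fin.snoc_last, Matrix.transpose_sub, Matrix.transpose_one,
        Matrix.transpose_mul, hYtt, Matrix.transpose_transpose]
      rw [Matrix.mul_sub _ 1, ← Matrix.mul_assoc _ Yᴴ, hzero, Matrix.zero_mul, sub_zero,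
        Matrix.mul_one, Matrix.mul_assoc, Matrix.sub_mul, Matrix.one_mul, Matrix.trace_sub,
        hΨ, trace_coeffMatrix hψ, ← hΨ, Matrix.mul_assoc N, Matrix.trace_mul_comm N,
        ← Matrix.mul_assoc Nᴴ, hl, Matrix.mul_assoc, Matrix.mul_assoc, ← Matrix.mul_assoc Y,
        hr', Matrix.mul_assoc D, hN, Matrix.mul_one, hD, Matrix.diagonal_mul_diagonal,
        Matrix.trace_diagonal, Fin.sum_univ_two]
      rw [addCorner_last_last]
      push_cast
      ring
    | cast y =>
      simp only [extendPOVM, Fin.snoc_last, Fin.snoc_castSucc,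
        Matrix.transpose_mul, hYtt, Matrix.transpose_transpose]
      rw [← Matrix.mul_assoc _ Yᴴ, hzero, Matrix.zero_mul, Matrix.zero_mul, Matrix.trace_zero]
      simp [addCorner]
  | cast x =>
    induction y using Fin.lastCases with
    | last =>
      simp only [extendPOVM, Fin.snoc_last, Fin.snoc_castSucc, Matrix.transpose_sub,
        Matrix.transpose_one, Matrix.transpose_mul, hYtt, Matrix.transpose_transpose]
      have hzero : N * T x * Nᴴ * Ψ * (1 - Yᴴ * Y) = 0 := by
        rw [Matrix.mul_assoc (N * T x), hl, Matrix.mul_sub, Matrix.mul_one,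
          Matrix.mul_assoc _ _ (Yᴴ * Y), Matrix.mul_assoc D, ← Matrix.mul_assoc Y, hY, Matrix.one_mul, sub_self]
      rw [hzero, Matrix.zero_mul, Matrix.trace_zero]
      simp [addCorner]
    | cast y =>
      rw [addCorner_castSucc_castSucc, hM]
      simp only [extendPOVM, Fin.snoc_castSucc, Matrix.transpose_mul, hYtt,
        Matrix.transpose_transpose]
      have h1 : N * T x * Nᴴ * Ψ * (Yᴴ * ((S y)ᵀ * Y)) * Ψᴴ
          = N * (T x * (Nᴴ * Ψ) * Yᴴ * (S y)ᵀ * (Y * Ψᴴ)) := by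
        simp only [Matrix.mul_assoc]
      rw [h1, hl, hr', Matrix.trace_mul_comm N]
      have h2 : T x * (D * Y) * Yᴴ * (S y)ᵀ * (D * Nᴴ) * N
          = T x * D * (Y * Yᴴ) * (S y)ᵀ * D * (Nᴴ * N) := by
        simp only [Matrix.mul_assoc]
      rw [h2, hY, hN, Matrix.mul_one, Matrix.mul_one]

/-! ### Generic points of the line with prescribed moments -/

theorem eventually_affine_pos {p : ℝ} (hp : 0 < p) (q : ℝ) :
    ∀ᶠ ε in 𝓝[>] (0 : ℝ), 0 < p + ε * q := by
  have hc : Continuous fun ε : ℝ => p + ε * q := by fun_prop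
  have : Tendsto (fun ε : ℝ => p + ε * q) (𝓝[>] 0) (𝓝 p) := by
    simpa using (hc.tendsto 0).mono_left nhdsWithin_le_nhds
  exact this.eventually (lt_mem_nhds hp)

/-- All points beyond the first three get a small weight `ε`, and Lagrange interpolation solves the
three moment equations for the rest. At `ε = 0` the sign hypotheses make the three solutions
positive, which persists for small `ε`. -/
theorem exists_pos_weights {n : ℕ} {α : Fin (n + 3) → ℝ} {v : ℝ} (h01 : α 0 < α 1)
    (h12 : α 1 < α 2) (hv12 : 0 < v + α 1 * α 2) (hv01 : 0 < v + α 0 * α 1)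
    (hv02 : v + α 0 * α 2 < 0) :
    ∃ w : Fin (n + 3) → ℝ, (∀ i, 0 < w i) ∧ ∑ i, w i = 1 ∧ ∑ i, w i * α i = 0 ∧
      ∑ i, w i * α i ^ 2 = v := by
  let β : Fin n → ℝ := fun i => α i.succ.succ.succ
  have h10 : 0 < α 1 - α 0 := sub_pos.2 h01
  have h21 : 0 < α 2 - α 1 := sub_pos.2 h12
  have h20 : 0 < α 2 - α 0 := by linarith
  let S₁ := ∑ i, β i
  let S₂ := ∑ i, β i ^ 2
  obtain ⟨ε, hε0, hε1, hε2, hε3⟩ := ((eventually_mem_nhdsWithin (a := (0 : ℝ)) (s := Set.Ioi 0)).and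
    ((eventually_affine_pos hv12 ((α 1 + α 2) * S₁ - S₂ - α 1 * α 2 * n)).and
    ((eventually_affine_pos (neg_pos.2 hv02) (S₂ + α 0 * α 2 * n - (α 0 + α 2) * S₁)).and
      (eventually_affine_pos hv01 ((α 0 + α 1) * S₁ - S₂ - α 0 * α 1 * n))))).exists
  refine ⟨Fin.cons ((v + α 1 * α 2 + ε * ((α 1 + α 2) * S₁ - S₂ - α 1 * α 2 * n))
      / ((α 1 - α 0) * (α 2 - α 0)))
    (Fin.cons ((-(v + α 0 * α 2) + ε * (S₂ + α 0 * α 2 * n - (α 0 + α 2) * S₁))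
      / ((α 1 - α 0) * (α 2 - α 1)))
    (Fin.cons ((v + α 0 * α 1 + ε * ((α 0 + α 1) * S₁ - S₂ - α 0 * α 1 * n))
      / ((α 2 - α 0) * (α 2 - α 1))) fun _ => ε)), ?_, ?_, ?_, ?_⟩
  · refine Fin.cases ?_ (Fin.cases ?_ (Fin.cases ?_ fun _ => ?_))
    · exact div_pos hε1 (mul_pos h10 h20)
    · exact div_pos hε2 (mul_pos h10 h21)
    · exact div_pos hε3 (mul_pos h20 h21)
    · exact hε0
  · rw [Fin.sum_univ_succ, Fin.sum_univ_succ, Fin.sum_univ_succ]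
    simp only [Fin.cons_zero, Fin.cons_succ, Finset.sum_const, Finset.card_univ, Fintype.card_fin,
      nsmul_eq_mul]
    field_simp
    ring
  · rw [Fin.sum_univ_succ, Fin.sum_univ_succ, Fin.sum_univ_succ]
    simp only [Fin.cons_zero, Fin.cons_succ, ← Finset.mul_sum]
    change _ * α 0 + (_ * α 1 + (_ * α 2 + ε * S₁)) = 0
    field_simp
    ring
  · rw [Fin.sum_univ_succ, Fin.sum_univ_succ, Fin.sum_univ_succ]
    simp only [Fin.cons_zero, Fin.cons_succ, ← Finset.mul_sum]
    change _ * α 0 ^ 2 + (_ * α 1 ^ 2 + (_ * α 2 ^ 2 + ε * S₂)) = v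
    field_simp
    ring

theorem exists_algebraicIndependent_with_moments (n : ℕ) {v v' : ℝ} (hv : 0 < v) (hv' : 0 < v') :
    ∃ α : Fin (n + 3) → ℝ, AlgebraicIndependent ℚ α ∧
      (∃ w : Fin (n + 3) → ℝ, (∀ i, 0 < w i) ∧ ∑ i, w i = 1 ∧ ∑ i, w i * α i = 0 ∧
        ∑ i, w i * α i ^ 2 = v) ∧
      ∃ w : Fin (n + 3) → ℝ, (∀ i, 0 < w i) ∧ ∑ i, w i = 1 ∧ ∑ i, w i * α i = 0 ∧
        ∑ i, w i * α i ^ 2 = v' := by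
  -- Outer points near `-K` and `K` make `α 0 * α 2` very negative; a middle point within `δ` of 0
  -- keeps the other two products above both `-v` and `-v'`. The same points thus serve both
  -- moments.
  obtain ⟨K, hK⟩ : ∃ K, K = 1 + v + v' := ⟨_, rfl⟩
  obtain ⟨δ, hδ0, hδ, hδ'⟩ : ∃ δ : ℝ, 0 < δ ∧ δ * (K + 1) ≤ v ∧ δ * (K + 1) ≤ v' := by
    have hK1 : 0 < K + 1 := by linarith
    refine ⟨min v v' / (K + 1), div_pos (lt_min hv hv') hK1, ?_, ?_⟩ <;>
    · rw [div_mul_cancel₀ _ hK1.ne']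
      simp
  have hδK : δ < K := by nlinarith
  obtain ⟨α, hα, hI⟩ := exists_algebraicIndependent_mem_Ioo (m := n + 3)
    (Fin.cons (-K - 1) (Fin.cons (-δ) (Fin.cons K fun _ => 0)))
    (Fin.cons (-K) (Fin.cons δ (Fin.cons (K + 1) fun _ => 1)))
    (Fin.cases (by simp) (Fin.cases (by simp [hδ0]) (Fin.cases (show K < K + 1 by linarith)
      fun _ => zero_lt_one)))
  have h0 : -K - 1 < α 0 ∧ α 0 < -K := hI 0
  have h1 : -δ < α 1 ∧ α 1 < δ := hI 1
  have h2 : K < α 2 ∧ α 2 < K + 1 := hI 2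
  have hprod : α 0 * α 2 < -(K * K) := by nlinarith
  have hb1 : -(δ * (K + 1)) < α 1 * α 2 := by nlinarith
  have hb2 : -(δ * (K + 1)) < α 0 * α 1 := by nlinarith
  have hKK : v + v' < K * K := by nlinarith
  refine ⟨α, hα, exists_pos_weights ?_ ?_ ?_ ?_ ?_, exists_pos_weights ?_ ?_ ?_ ?_ ?_⟩ <;> linarith

/-- Any two positive Schmidt coefficients allow pairs of measurements with any number `m ≥ 2` of
outcomes whose joint statistics are a rescaled distance matrix of generic points. -/
theorem exists_povm_scaledSqDist {m : ℕ} (hm : 2 ≤ m) {s : Fin 2 → ℝ} (hs : ∀ i, 0 < s i) :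
    ∃ (α c d : Fin m → ℝ) (T S : Fin m → Matrix (Fin 2) (Fin 2) ℂ), AlgebraicIndependent ℚ α ∧
      (∀ x, 0 < c x) ∧ (∀ y, 0 < d y) ∧ IsPOVM T ∧ IsPOVM S ∧
      ∀ x y, ((c x * d y * (α x - α y) ^ 2 : ℝ) : ℂ) =
        (T x * Matrix.diagonal (fun i => (s i : ℂ)) * (S y)ᵀ *
          Matrix.diagonal (fun i => (s i : ℂ))).trace := by
  have hs0 := hs 0
  have hs1 := hs 1
  rcases hm.lt_or_eq with hm | rfl
  · obtain ⟨n, rfl⟩ := Nat.exists_eq_add_of_le' hm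
    -- The second moment `s 0 ^ 2 / s 1 ^ 2` offsets the factor `s 1 / s 0` in Bob's vectors, which
    -- itself balances the unequal Schmidt coefficients.
    obtain ⟨α, hα, ⟨c, hc, hc0, hc1, hc2⟩, ⟨d, hd, hd0, hd1, hd2⟩⟩ :=
      exists_algebraicIndependent_with_moments n one_pos (div_pos (pow_pos hs0 2) (pow_pos hs1 2))
    have hne0 : (s 0 : ℂ) ≠ 0 := by exact_mod_cast hs0.ne'
    have hne1 : (s 1 : ℂ) ≠ 0 := by exact_mod_cast hs1.ne'
    have hc0' : ∑ i, (c i : ℂ) = 1 := by exact_mod_cast hc0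
    have hc1' : ∑ i, (c i : ℂ) * α i = 0 := by exact_mod_cast hc1
    have hc2' : ∑ i, (c i : ℂ) * α i ^ 2 = 1 := by exact_mod_cast hc2
    have hd0' : ∑ i, (d i : ℂ) = 1 := by exact_mod_cast hd0
    have hd1' : ∑ i, (d i : ℂ) * α i = 0 := by exact_mod_cast hd1
    have hd2' : ∑ i, (d i : ℂ) * α i ^ 2 = (s 0 : ℂ) ^ 2 / (s 1 : ℂ) ^ 2 := by exact_mod_cast hd2
    refine ⟨α, c, fun y => s 1 ^ 2 * d y,
      fun x => (c x : ℂ) • Matrix.vecMulVec ![1, (α x : ℂ)] (star ![1, (α x : ℂ)]),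
      fun y => (d y : ℂ) • Matrix.vecMulVec ![(s 1 / s 0 * α y : ℂ), -1]
        (star ![(s 1 / s 0 * α y : ℂ), -1]),
      hα, hc, fun y => mul_pos (pow_pos hs1 2) (hd y),
      ⟨fun x => (Matrix.posSemidef_vecMulVec_self_star _).smul (by exact_mod_cast (hc x).le), ?_⟩,
      ⟨fun y => (Matrix.posSemidef_vecMulVec_self_star _).smul (by exact_mod_cast (hd y).le), ?_⟩,
      fun x y => ?_⟩
    · ext i j
      simp only [Matrix.sum_apply, Matrix.smul_apply, Matrix.vecMulVec_apply, Pi.star_apply]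
      fin_cases i <;> fin_cases j <;> simp
      · exact hc0'
      · exact hc1'
      · exact hc1'
      · rw [← hc2']
        exact Finset.sum_congr rfl fun i _ => by ring
    · ext i j
      simp only [Matrix.sum_apply, Matrix.smul_apply, Matrix.vecMulVec_apply, Pi.star_apply]
      fin_cases i <;> fin_cases j <;> simp
      · rw [Finset.sum_congr rfl fun i _ => show _ = (s 1 / s 0 : ℂ) ^ 2 * (d i * α i ^ 2) by ring,
          ← Finset.mul_sum, hd2']
        field_simp
      · rw [Finset.sum_congr rfl fun i _ => show _ = (s 1 / s 0 : ℂ) * (d i * α i) by ring,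
          ← Finset.mul_sum, hd1', mul_zero]
      · rw [Finset.sum_congr rfl fun i _ => show _ = (s 1 / s 0 : ℂ) * (d i * α i) by ring,
          ← Finset.mul_sum, hd1', mul_zero]
      · exact hd0'
    · simp only [Matrix.trace, Matrix.diag, Matrix.mul_apply,
        Fin.sum_univ_two, Matrix.transpose_apply, Matrix.smul_apply, Matrix.vecMulVec_apply,
        Pi.star_apply]
      simp
      field_simp
      ring
  · obtain ⟨α, hα⟩ := exists_algebraicIndependent_real 2
    have h01 : α 0 - α 1 ≠ 0 := sub_ne_zero.2 fun h => by simpa using hα.injective h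
    have hpos : 0 < (α 0 - α 1) ^ 2 := by positivity
    have h01' : (α 0 - α 1 : ℂ) ≠ 0 := by exact_mod_cast h01
    let e : Fin 2 → Matrix (Fin 2) (Fin 2) ℂ := fun i =>
      Matrix.vecMulVec (Pi.single i 1) (star (Pi.single i 1))
    have he : e 0 + e 1 = 1 := by
      ext i j
      fin_cases i <;> fin_cases j <;> simp [e, Matrix.vecMulVec_apply]
    refine ⟨α, fun x => s x ^ 2 / (α 0 - α 1) ^ 2, 1, e, ![e 1, e 0], hα,
      fun x => div_pos (pow_pos (hs x) 2) hpos, fun _ => one_pos,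
      ⟨fun x => Matrix.posSemidef_vecMulVec_self_star _, by rw [Fin.sum_univ_two, he]⟩,
      ⟨fun y => ?_, ?_⟩, fun x y => ?_⟩
    · fin_cases y <;> exact Matrix.posSemidef_vecMulVec_self_star _
    · rw [Fin.sum_univ_two, ← he, add_comm]
      rfl
    · simp only [Matrix.trace, Matrix.diag, Matrix.mul_apply,
        Fin.sum_univ_two, Matrix.transpose_apply]
      fin_cases x <;> fin_cases y <;> simp [e, Matrix.vecMulVec_apply]
      · field_simp
      · rw [← neg_sub (α 0 : ℂ), neg_sq]
        field_simp

/-! ### Costs -/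

/-- Absorbing the seed `Q` into Bob's channel gives a nonnegative factorization with `k` terms, and
into Alice's channel one with `l` terms. -/
theorem IsScaledSqDist.le_of_classicallyGenerates {m k l : ℕ} {α : Fin m → ℝ} (hm : 2 ≤ m)
    (hα : AlgebraicIndependent ℚ α) {M : Matrix (Fin m) (Fin m) ℝ} (hM : IsScaledSqDist α M)
    {c : ℝ} {Q : Matrix (Fin k) (Fin l) ℝ} (hQ : IsCorrelation Q)
    (h : ClassicallyGenerates Q (addCorner M c)) :
    2 * √(m : ℝ) - 2 ≤ k ∧ 2 * √(m : ℝ) - 2 ≤ l := by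
  obtain ⟨A, B, hA, hB, hAB⟩ := h
  have hMxy : ∀ x y, M x y = ∑ i, ∑ j, A x.castSucc i * B y.castSucc j * Q i j := fun x y => by
    rw [← hAB, addCorner_castSucc_castSucc]
  constructor
  · refine hM.le_of_factorization hm hα (u := fun i x => A x.castSucc i)
      (v := fun i y => ∑ j, B y.castSucc j * Q i j) (fun i x => hA.nonneg _ _)
      (fun i y => Finset.sum_nonneg fun j _ => mul_nonneg (hB.nonneg _ _) (hQ.nonneg _ _))
      fun x y => ?_
    simp_rw [hMxy, Finset.mul_sum, mul_assoc]
  · refine hM.le_of_factorization hm hα (u := fun j x => ∑ i, A x.castSucc i * Q i j)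
      (v := fun j y => B y.castSucc j)
      (fun j x => Finset.sum_nonneg fun i _ => mul_nonneg (hA.nonneg _ _) (hQ.nonneg _ _))
      (fun j y => hB.nonneg _ _) fun x y => ?_
    rw [hMxy, Finset.sum_comm]
    refine Finset.sum_congr rfl fun j _ => ?_
    rw [Finset.sum_mul]
    exact Finset.sum_congr rfl fun i _ => by ring

theorem natCast_le_size {k l n : ℕ} (hk : 2 ^ n ≤ k) (hl : 2 ^ n ≤ l) :
    (n : ℝ≥0∞) ≤ size k l := by
  have h1 : ∀ j : ℕ, 2 ^ n ≤ j → n ≤ Nat.clog 2 j := fun j hj => by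
    simpa [Nat.clog_pow 2 n one_lt_two] using Nat.clog_mono_right 2 hj
  rw [size, ENNReal.le_div_iff_mul_le (Or.inl two_ne_zero) (Or.inl ENNReal.ofNat_ne_top)]
  have := h1 k hk
  have := h1 l hl
  exact_mod_cast (by lia : n * 2 ≤ Nat.clog 2 k + Nat.clog 2 l)

theorem IsScaledSqDist.natCast_le_classicalCost {m n : ℕ} {α : Fin m → ℝ}
    (hm : (2 ^ n + 2) ^ 2 ≤ m) (hα : AlgebraicIndependent ℚ α) {M : Matrix (Fin m) (Fin m) ℝ}
    (hM : IsScaledSqDist α M) (c : ℝ) : (n : ℝ≥0∞) ≤ classicalCost (addCorner M c) := by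
  have hm2 : 2 ≤ m := by nlinarith [Nat.zero_le (2 ^ n)]
  refine le_iInf fun k => le_iInf fun l => le_iInf fun Q => le_iInf fun hQ => ?_
  obtain ⟨hk, hl⟩ := hM.le_of_classicallyGenerates hm2 hα hQ.1 hQ.2
  have h1 : (2 : ℝ) ^ n + 2 ≤ √(m : ℝ) := Real.le_sqrt_of_sq_le (by exact_mod_cast hm)
  have h2 : (0 : ℝ) < 2 ^ n := by positivity
  refine natCast_le_size ?_ ?_
  · have : (2 : ℝ) ^ n ≤ k := by linarith
    exact_mod_cast this
  · have : (2 : ℝ) ^ n ≤ l := by linarith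
    exact_mod_cast this

theorem quantumCost_le_size {a b n : ℕ} {ψ : EuclideanSpace ℂ (Fin a × Fin b)} (hψ : ‖ψ‖ = 1)
    {P : Matrix (Fin n) (Fin n) ℝ} (hP : Generates 0 (pureState ψ) P) :
    quantumCost 0 P ≤ size a b :=
  iInf_le_of_le a <| iInf_le_of_le b <| iInf_le_of_le (pureState ψ) <|
    iInf_le_of_le ⟨isState_pureState hψ, hP⟩ le_rfl

theorem tendsto_quantumAdvantage_top {P : (m : ℕ) → Matrix (Fin (m + 1)) (Fin (m + 1)) ℝ}
    {C : ℝ≥0∞} (hC : C ≠ ∞) (hq : ∀ᶠ m in atTop, quantumCost 0 (P m) ≤ C)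
    (hc : ∀ n : ℕ, ∀ᶠ m in atTop, (n : ℝ≥0∞) ≤ classicalCost (P m)) :
    Tendsto (fun m => quantumAdvantage 0 (P m)) atTop (𝓝 ∞) := by
  rw [ENNReal.tendsto_nhds_top_iff_nat]
  intro n
  -- `C + 1` replaces `C` so that the denominator is nonzero.
  have hC1 : C + 1 ≠ ∞ := ENNReal.add_ne_top.2 ⟨hC, ENNReal.one_ne_top⟩
  obtain ⟨B, hB⟩ := ENNReal.exists_nat_gt (ENNReal.mul_ne_top (ENNReal.natCast_ne_top n) hC1)
  filter_upwards [hq, hc B] with m hqm hcm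
  calc (n : ℝ≥0∞) < B / (C + 1) :=
        (ENNReal.lt_div_iff_mul_lt (Or.inl (by simp)) (Or.inl hC1)).2 hB
    _ ≤ quantumAdvantage 0 (P m) := ENNReal.div_le_div hcm (hqm.trans le_self_add)

/-- A constant-outcome measurement supplies the members `m < 2` of the family, on which no block
form is imposed. -/
theorem exists_generates {a b : ℕ} (ρ : BiMatrix a b) (hρ : IsState ρ) (n : ℕ) :
    ∃ P : Matrix (Fin (n + 1)) (Fin (n + 1)) ℝ, Generates 0 ρ P := by
  have hpovm : ∀ d, IsPOVM (Pi.single 0 1 : Fin (n + 1) → Matrix (Fin d) (Fin d) ℂ) := fun d => by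
    refine ⟨fun x => ?_, ?_⟩
    · by_cases hx : x = 0
      · subst hx
        rw [Pi.single_eq_same]
        exact Matrix.PosSemidef.one
      · rw [Pi.single_eq_of_ne hx]
        exact Matrix.PosSemidef.zero
    · rw [Finset.sum_pi_single']
      simp
  refine ⟨Matrix.of fun x y => if x = 0 ∧ y = 0 then 1 else 0, Pi.single 0 1, Pi.single 0 1,
    hpovm a, hpovm b, fun x y => ?_⟩
  rw [noise_zero, Matrix.of_apply]
  by_cases hx : x = 0
  · by_cases hy : y = 0
    · subst hx hy
      simp [hρ.trace_eq_one]
    · simp [hy]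
  · simp [hx]

theorem sum_sq_dist_pos {m : ℕ} (hm : 2 ≤ m) {α : Fin m → ℝ} (hα : Function.Injective α) :
    0 < ∑ i, ∑ j, (α i - α j) ^ 2 := by
  refine Finset.sum_pos' (fun i _ => Finset.sum_nonneg fun j _ => sq_nonneg _)
    ⟨⟨0, by lia⟩, Finset.mem_univ _, Finset.sum_pos' (fun j _ => sq_nonneg _)
      ⟨⟨1, by lia⟩, Finset.mem_univ _, ?_⟩⟩
  have : α ⟨0, by lia⟩ - α ⟨1, by lia⟩ ≠ 0 := sub_ne_zero.2 fun h => by simpa using hα h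
  positivity

theorem rescaledEdm_apply {m : ℕ} (α l r : Fin m → ℝ) (x y : Fin m) :
    rescaledEdm α l r x y = l x * ((α x - α y) ^ 2 / ∑ i, ∑ j, (α i - α j) ^ 2) * r y := by
  rw [rescaledEdm, Matrix.mul_diagonal, Matrix.diagonal_mul, edm, Matrix.of_apply]

theorem isScaledSqDist_rescaledEdm {m : ℕ} (hm : 2 ≤ m) {α l r : Fin m → ℝ}
    (hα : Function.Injective α) (hl : ∀ x, 0 < l x) (hr : ∀ y, 0 < r y) :
    IsScaledSqDist α (rescaledEdm α l r) := by
  have hS := sum_sq_dist_pos hm hα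
  refine ⟨fun x => l x / ∑ i, ∑ j, (α i - α j) ^ 2, r, fun x => div_pos (hl x) hS, hr,
    fun x y => ?_⟩
  rw [rescaledEdm_apply]
  ring

theorem isScaledSqDist_edm {m : ℕ} (hm : 2 ≤ m) {α : Fin m → ℝ} (hα : Function.Injective α) :
    IsScaledSqDist α (edm α) := by
  have h := isScaledSqDist_rescaledEdm hm hα (l := 1) (r := 1) (fun _ => one_pos) fun _ => one_pos
  have h1 : rescaledEdm α 1 1 = edm α := by
    ext x y
    rw [rescaledEdm_apply, edm, Matrix.of_apply, Pi.one_apply, Pi.one_apply, one_mul, mul_one]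
  rwa [h1] at h

theorem theorem1 {a b : ℕ} (ψ : EuclideanSpace ℂ (Fin a × Fin b)) (hψ : ‖ψ‖ = 1)
    (hent : IsEntangled ψ) :
    ∃ P : (m : ℕ) → Matrix (Fin (m + 1)) (Fin (m + 1)) ℝ,
      (∀ m, 1 ≤ m → IsCorrelation (P m) ∧ Generates 0 (pureState ψ) (P m)) ∧
      Tendsto (fun m => quantumAdvantage 0 (P m)) atTop (𝓝 ∞) ∧
      ∃ p : ℝ, 0 < p ∧ p ≤ 1 ∧
        ∀ m, 2 ≤ m → ∃ α l r : Fin m → ℝ,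
          Function.Injective α ∧ (∀ x, 0 < l x) ∧ (∀ y, 0 < r y) ∧
          P m = addCorner (p • rescaledEdm α l r) (1 - p) ∧
          psdRank (edm α) = 2 ∧ psdRank (rescaledEdm α l r) = 2 ∧
          2 * √(m : ℝ) - 2 ≤ nonnegRank (edm α) ∧
          2 * √(m : ℝ) - 2 ≤ nonnegRank (rescaledEdm α l r) := by
  obtain ⟨N, Y, s, hs, hpair⟩ := exists_isSchmidtPair hent
  set p := s 0 ^ 2 + s 1 ^ 2 with hp
  have hp0 : 0 < p := add_pos (pow_pos (hs 0) 2) (pow_pos (hs 1) 2)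
  have hfam : ∀ m, ∃ P : Matrix (Fin (m + 1)) (Fin (m + 1)) ℝ, Generates 0 (pureState ψ) P ∧
      (2 ≤ m → ∃ α l r : Fin m → ℝ, AlgebraicIndependent ℚ α ∧ (∀ x, 0 < l x) ∧ (∀ y, 0 < r y) ∧
        P = addCorner (p • rescaledEdm α l r) (1 - p)) := by
    intro m
    by_cases hm : 2 ≤ m
    · obtain ⟨α, c, d, T, S, hα, hc, hd, hT, hS, hTS⟩ := exists_povm_scaledSqDist hm hs
      have hsum := sum_sq_dist_pos hm hα.injective
      have hgen := generates_addCorner hψ hpair hT hS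
        (M := Matrix.of fun x y => c x * d y * (α x - α y) ^ 2) fun x y => by
          rw [Matrix.of_apply, hTS x y]
      -- The left scaling undoes the normalization of `edm` and the prefactor `p`.
      refine ⟨_, hgen, fun _ => ⟨α, fun x => c x * (∑ i, ∑ j, (α i - α j) ^ 2) / p, d, hα,
        fun x => div_pos (mul_pos (hc x) hsum) hp0, hd, ?_⟩⟩
      congr 1
      ext x y
      rw [Matrix.smul_apply, rescaledEdm_apply, Matrix.of_apply, smul_eq_mul]
      field_simp
    · obtain ⟨P, hP⟩ := exists_generates (pureState ψ) (isState_pureState hψ) m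
      exact ⟨P, hP, fun h => absurd h hm⟩
  choose P hgen hform using hfam
  refine ⟨P, fun m _ => ⟨Generates.isCorrelation hψ (hgen m), hgen m⟩, ?_, p, hp0, ?_, ?_⟩
  · refine tendsto_quantumAdvantage_top (C := size a b)
      (ENNReal.div_ne_top (ENNReal.natCast_ne_top _) two_ne_zero)
      (Eventually.of_forall fun m => quantumCost_le_size hψ (hgen m)) fun n => ?_
    filter_upwards [eventually_ge_atTop ((2 ^ n + 2) ^ 2)] with m hm
    have hm2 : 2 ≤ m := by nlinarith [Nat.zero_le (2 ^ n)]
    obtain ⟨α, l, r, hα, hl, hr, hP⟩ := hform m hm2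
    rw [hP]
    refine IsScaledSqDist.natCast_le_classicalCost hm hα ?_ _
    have h1 : p • rescaledEdm α l r = rescaledEdm α (fun x => p * l x) r := by
      ext x y
      rw [Matrix.smul_apply, rescaledEdm_apply, rescaledEdm_apply, smul_eq_mul]
      ring
    rw [h1]
    exact isScaledSqDist_rescaledEdm hm2 hα.injective (fun x => mul_pos hp0 (hl x)) hr
  -- `p ≤ 1` because `1 - p` is an entry of the correlation `P 2`.
  · obtain ⟨α, l, r, -, -, -, hP⟩ := hform 2 le_rfl
    have h1 := (Generates.isCorrelation hψ (hgen 2)).nonneg (Fin.last 2) (Fin.last 2)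
    rwa [hP, addCorner_last_last, sub_nonneg] at h1
  · intro m hm
    obtain ⟨α, l, r, hα, hl, hr, hP⟩ := hform m hm
    have h1 := isScaledSqDist_edm hm hα.injective
    have h2 := isScaledSqDist_rescaledEdm hm hα.injective hl hr
    exact ⟨α, l, r, hα.injective, hl, hr, hP, h1.psdRank_eq_two hm hα.injective,
      h2.psdRank_eq_two hm hα.injective, h1.le_nonnegRank hm hα, h2.le_nonnegRank hm hα⟩
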